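/- For $n\in\mathbb{N}=\{1,2,3,\dots\}$ let $L_n$ be the $n\times n$ real matrix with entries $(L_n)_{i,j}=\dfrac{1}{\max(i,j)+1}$, $i,j=0,1,\dots,n-1$, and for $\xi>0$ put $$q_n(\xi):=\det\!\left(1-\left(\tfrac14+\xi^2\right)L_n\right),\qquad F(\xi):=\frac{\Gamma(1+2\mathrm{i}\xi)}{\Gamma(1/2+\mathrm{i}\xi)^3}.$$ Let $K>0$. There exists a constant $C_K>0$, depending only on $K$, such that for all $\xi\in(0,K]$ and all $n\in\mathbb{N}$ one has $$q_n(\xi)=\frac{1}{\xi\sqrt n}\Bigl[\operatorname{Im}F(\xi)\,\cos(\xi\log n)+\operatorname{Re}F(\xi)\,\sin(\xi\log n)\Bigr]+R_n(\xi),\qquad\text{where}\quad |R_n(\xi)|\le\frac{C_K}{n\,\xi}.$$ -/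

import Mathlib

noncomputable section

/-- The `n × n` section `L_n` of the Hilbert `L`-matrix: its entries are
`1 / (max i j + 1)` for `i, j = 0, …, n - 1`. -/
def hilbertLMatrix (n : ℕ) : Matrix (Fin n) (Fin n) ℝ :=
  Matrix.of fun i j => 1 / (max ((i : ℕ) : ℝ) ((j : ℕ) : ℝ) + 1)

/-- `q_n(ξ) = det (1 - (1/4 + ξ²) L_n)`. -/
def qPoly (n : ℕ) (ξ : ℝ) : ℝ :=
  (1 - ((1 : ℝ) / 4 + ξ ^ 2) • hilbertLMatrix n).det

/-- `F(ξ) = Γ(1 + 2iξ) / Γ(1/2 + iξ)³`. -/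
def gammaQuotient (ξ : ℝ) : ℂ :=
  Complex.Gamma (1 + 2 * Complex.I * (ξ : ℂ)) /
    Complex.Gamma (1 / 2 + Complex.I * (ξ : ℂ)) ^ 3

end

open Complex MeasureTheory Set

/-! Write `a = 1/2 + iξ`, `b = 1/2 - iξ`, so that `a + b = 1` and `ab = 1/4 + ξ²`. Off the diagonal,
consecutive rows of `L_n` are proportional, so `q_n` obeys a three-term recurrence
(`qPoly_recurrence`). It is solved by the binomial transform of `p k = (a)_k (b)_k / k!²`, a
terminating `₃F₂(-n, a, b; 1, 1; 1)`.

Up to the factor `(Γ(a)Γ(b))²`, `p k` is `B(a+k, b) B(b+k, a)`, the `k`-th moment of a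
multiplicative convolution of two Beta densities. With `exp (-x)` as the variable this is an
additive convolution `Ψ`, and `(Γ(a)Γ(b))² q_n = ∫ (1 - e^{-x})^n Ψ(x) dx`
(`qPoly_mul_eq_integral`).

Large `n` thus probes `Ψ` at large `x`. By symmetry `Ψ` is twice the real part of half the
convolution. Freezing the slowly varying factor and integrating by parts gives `ξ Ψ(x) = Im (G
e^{-bx}) + O(e^{-x} / (1 - e^{-x}))` with `G = (1-b) B(2-2b, b)` (`norm_half_conv_sub_main_le`).
Integrated against `(1 - e^{-x})^n`, the main term yields `Im (G B(b, n+1))` and the error `O(1/n)`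
(`abs_mul_qPoly_sub_im_le`). Finally `B(b, n+1) = n^{-b} Γ(b) + O(1/n)` and `G Γ(b) = |Γ(b)|⁴ F(ξ)`.
All constants are continuous in `ξ` on `[0, K]`, hence bounded there. -/

/-! ### Determinants and the three-term recurrence -/

/-- Expansion of a determinant whose last row and column vanish off the last two entries. -/
theorem det_of_last_row_col_eq_zero {R : Type*} [CommRing R] {n : ℕ}
    (M : Matrix (Fin (n + 2)) (Fin (n + 2)) R)
    (hrow : ∀ j : Fin n, M (Fin.last _) j.castSucc.castSucc = 0)
    (hcol : ∀ i : Fin n, M i.castSucc.castSucc (Fin.last _) = 0) :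
    M.det = M (Fin.last _) (Fin.last _) * (M.submatrix Fin.castSucc Fin.castSucc).det -
      M (Fin.last _) (Fin.last n).castSucc * M (Fin.last n).castSucc (Fin.last _) *
        (M.submatrix (fun i : Fin n => i.castSucc.castSucc)
          (fun i : Fin n => i.castSucc.castSucc)).det := by
  have key : (M.submatrix (Fin.last (n + 1)).succAbove (Fin.last n).castSucc.succAbove).det =
      M (Fin.last n).castSucc (Fin.last _) * (M.submatrix (fun i : Fin n => i.castSucc.castSucc)
          (fun i : Fin n => i.castSucc.castSucc)).det := by
    have hsa : ∀ j : Fin n, (Fin.last n).castSucc.succAbove j.castSucc = j.castSucc.castSucc := by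
      intro j
      apply Fin.succAbove_of_castSucc_lt
      simp [Fin.lt_def]
    have hsl : (Fin.last n).castSucc.succAbove (Fin.last n) = Fin.last (n + 1) := by
      rw [Fin.succAbove_of_le_castSucc _ _ le_rfl, Fin.succ_last]
    rw [Matrix.det_succ_column _ (Fin.last n), Fin.sum_univ_castSucc]
    simp only [Matrix.submatrix_apply, hsl, Fin.succAbove_last, hcol, mul_zero, zero_mul,
      Finset.sum_const_zero, zero_add, Fin.val_last, Matrix.submatrix_submatrix]
    rw [Even.neg_one_pow ⟨n, rfl⟩, one_mul]
    congr 2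
    ext i j
    simp [hsa]
  rw [Matrix.det_succ_row _ (Fin.last (n + 1)), Fin.sum_univ_castSucc, Fin.sum_univ_castSucc]
  simp only [hrow, mul_zero, zero_mul, Finset.sum_const_zero, zero_add, key]
  simp only [Fin.val_last, Fin.val_castSucc, Fin.succAbove_last]
  rw [Even.neg_one_pow ⟨n + 1, rfl⟩, Odd.neg_one_pow ⟨n, by ring⟩]
  ring

/-- Recurrence for leading principal minors when row and column `n + 1` are, before index `n`,
`ρ` times row and column `n`. -/
theorem det_principal_minor_recurrence {R : Type*} [CommRing R] (a : ℕ → ℕ → R) (n : ℕ) (ρ : R)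
    (hrow : ∀ j < n, a (n + 1) j = ρ * a n j) (hcol : ∀ i < n, a i (n + 1) = ρ * a i n) :
    (Matrix.of fun i j : Fin (n + 2) => a i j).det =
      (a (n + 1) (n + 1) - ρ * a n (n + 1) - ρ * (a (n + 1) n - ρ * a n n)) *
          (Matrix.of fun i j : Fin (n + 1) => a i j).det -
        (a (n + 1) n - ρ * a n n) * (a n (n + 1) - ρ * a n n) *
          (Matrix.of fun i j : Fin n => a i j).det := by
  have hne : Fin.last (n + 1) ≠ (Fin.last n).castSucc := by simp [Fin.ext_iff]
  set A : Matrix (Fin (n + 2)) (Fin (n + 2)) R := Matrix.of fun i j => a i j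
  -- Subtracting `ρ` times row `n`, then `ρ` times column `n`, clears the last row and column before
  -- index `n`.
  rw [← Matrix.det_updateRow_add_smul_self A hne (-ρ)]
  set B := A.updateRow (Fin.last (n + 1)) (A (Fin.last (n + 1)) + -ρ • A (Fin.last n).castSucc)
  rw [← Matrix.det_updateCol_add_smul_self B hne (-ρ)]
  rw [det_of_last_row_col_eq_zero]
  · have h1 : ∀ i : Fin (n + 1), i.castSucc ≠ Fin.last (n + 1) := fun i => Fin.castSucc_ne_last i
    have e1 : (B.updateCol (Fin.last (n + 1)) (fun k => B k (Fin.last (n + 1)) +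
        -ρ • B k (Fin.last n).castSucc)).submatrix Fin.castSucc Fin.castSucc =
        Matrix.of fun i j : Fin (n + 1) => a i j := by
      ext i j
      simp [B, Matrix.updateRow_apply, A, h1]
    have e2 : (B.updateCol (Fin.last (n + 1)) (fun k => B k (Fin.last (n + 1)) +
        -ρ • B k (Fin.last n).castSucc)).submatrix (fun i : Fin n => i.castSucc.castSucc)
          (fun i : Fin n => i.castSucc.castSucc) =
        Matrix.of fun i j : Fin n => a i j := by
      ext i j
      simp [B, Matrix.updateRow_apply, A, h1]
    rw [e1, e2]
    simp [B, Matrix.updateRow_apply, A, h1]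
    ring
  · intro j
    simp [B, Matrix.updateRow_apply, A, hrow j j.2]
  · intro i
    simp [B, Matrix.updateRow_apply, A, hcol i i.2]

theorem qPoly_eq_det (n : ℕ) (ξ : ℝ) :
    qPoly n ξ = (Matrix.of fun i j : Fin n => (if (i : ℕ) = j then (1 : ℝ) else 0) -
      (1 / 4 + ξ ^ 2) * (1 / (max ((i : ℕ) : ℝ) ((j : ℕ) : ℝ) + 1))).det := by
  unfold qPoly hilbertLMatrix
  congr 1
  ext i j
  simp [Matrix.one_apply, Fin.ext_iff]

theorem qPoly_zero (ξ : ℝ) : qPoly 0 ξ = 1 := by simp [qPoly]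

theorem qPoly_one (ξ : ℝ) : qPoly 1 ξ = 1 - (1 / 4 + ξ ^ 2) := by
  simp [qPoly, hilbertLMatrix]

theorem qPoly_recurrence (n : ℕ) (ξ : ℝ) :
    ((n : ℝ) + 2) ^ 2 * qPoly (n + 2) ξ =
      (((n : ℝ) + 2) ^ 2 + ((n : ℝ) + 1) ^ 2 - (1 / 4 + ξ ^ 2)) * qPoly (n + 1) ξ -
        ((n : ℝ) + 1) ^ 2 * qPoly n ξ := by
  have hn1 : (n : ℝ) + 1 ≠ 0 := by positivity
  have hn2 : (n : ℝ) + 2 ≠ 0 := by positivity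
  have hn3 : (n : ℝ) + 1 + 1 ≠ 0 := by positivity
  have hm : max (n : ℝ) (n + 1) = n + 1 := max_eq_right (by linarith)
  have hm' : max ((n : ℝ) + 1) n = n + 1 := max_eq_left (by linarith)
  simp only [qPoly_eq_det]
  -- To the left of the diagonal, row `m` of `L` is constantly `1 / (m + 1)`; `ρ` is the ratio for
  -- rows `n + 1` and `n`.
  rw [det_principal_minor_recurrence (fun i j : ℕ => (if (i : ℕ) = j then (1 : ℝ) else 0) -
      (1 / 4 + ξ ^ 2) * (1 / (max (i : ℝ) (j : ℝ) + 1))) n (((n : ℝ) + 1) / (n + 2))]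
  · simp only [if_true, Nat.succ_ne_self, (Nat.succ_ne_self n).symm, if_false, max_self,
      Nat.cast_add, Nat.cast_one, hm, hm']
    field_simp
    ring
  · intro j hj
    have h1 : max ((n + 1 : ℕ) : ℝ) (j : ℝ) = n + 1 := by
      rw [max_eq_left (by exact_mod_cast (by omega : j ≤ n + 1))]; push_cast; ring
    have h2 : max (n : ℝ) (j : ℝ) = n := max_eq_left (by exact_mod_cast hj.le)
    simp only [h1, h2]
    rw [if_neg (by omega), if_neg (by omega)]
    field_simp
    ring
  · intro j hj
    have h1 : max (j : ℝ) ((n + 1 : ℕ) : ℝ) = n + 1 := by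
      rw [max_eq_right (by exact_mod_cast (by omega : j ≤ n + 1))]; push_cast; ring
    have h2 : max (j : ℝ) (n : ℝ) = n := max_eq_right (by exact_mod_cast hj.le)
    simp only [h1, h2]
    rw [if_neg (by omega), if_neg (by omega)]
    field_simp
    ring

/-! ### Solving the recurrence by a binomial transform -/

/-- The binomial transform of a sequence with `(k + 1)² p (k + 1) = (k² + k + μ) p k` satisfies
the three-term recurrence of the continuous dual Hahn polynomials. -/
theorem binomial_transform_recurrence (μ : ℂ) (p : ℕ → ℂ)
    (hp : ∀ k : ℕ, ((k : ℂ) + 1) ^ 2 * p (k + 1) = ((k : ℂ) ^ 2 + k + μ) * p k) (n : ℕ) :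
    ((n : ℂ) + 2) ^ 2 * (∑ k ∈ Finset.range (n + 3), (-1) ^ k * ((n + 2).choose k : ℂ) * p k) =
      (((n : ℂ) + 2) ^ 2 + ((n : ℂ) + 1) ^ 2 - μ) *
        (∑ k ∈ Finset.range (n + 2), (-1) ^ k * ((n + 1).choose k : ℂ) * p k) -
      ((n : ℂ) + 1) ^ 2 * (∑ k ∈ Finset.range (n + 1), (-1) ^ k * (n.choose k : ℂ) * p k) := by
  set N := n + 3 with hN
  have ext : ∀ m, m < N → ∑ k ∈ Finset.range (m + 1), (-1) ^ k * (m.choose k : ℂ) * p k =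
      ∑ k ∈ Finset.range N, (-1) ^ k * (m.choose k : ℂ) * p k := by
    intro m hm
    apply Finset.sum_subset (Finset.range_mono (by omega))
    intro k _ hk
    rw [Nat.choose_eq_zero_of_lt (by simpa using hk)]
    simp
  rw [ext n (by omega), ext (n + 1) (by omega)]
  rw [Finset.mul_sum, Finset.mul_sum, Finset.mul_sum, ← sub_eq_zero, ← Finset.sum_sub_distrib,
    ← Finset.sum_sub_distrib]
  -- Telescoping certificate. The truncated `k - 1` at `k = 0` is harmless because of the factor `k
  -- ^ 2`, and `G N = 0` because the binomial coefficient vanishes.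
  let G : ℕ → ℂ := fun k => -(-1) ^ k * ((n + 1).choose (k - 1) : ℂ) * (k : ℂ) ^ 2 * p k
  have hG : ∀ k ∈ Finset.range N, ((n : ℂ) + 2) ^ 2 * ((-1) ^ k * ((n + 2).choose k : ℂ) * p k) -
      ((((n : ℂ) + 2) ^ 2 + ((n : ℂ) + 1) ^ 2 - μ) * ((-1) ^ k * ((n + 1).choose k : ℂ) * p k) -
        ((n : ℂ) + 1) ^ 2 * ((-1) ^ k * (n.choose k : ℂ) * p k)) = G (k + 1) - G k := by
    intro k _
    have hch : ((n : ℂ) + 2) ^ 2 * (n + 2).choose k -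
        (((n : ℂ) + 2) ^ 2 + ((n : ℂ) + 1) ^ 2 + k ^ 2 + k) * (n + 1).choose k +
        ((n : ℂ) + 1) ^ 2 * n.choose k = (k : ℂ) ^ 2 * (n + 1).choose (k - 1) := by
      rcases k with _ | j
      · simp
      · have e1 : ((n + 2).choose (j + 1) : ℂ) = (n + 1).choose j + (n + 1).choose (j + 1) := by
          exact_mod_cast Nat.choose_succ_succ (n + 1) j
        have e2 : ((n + 1).choose (j + 1) : ℂ) = n.choose j + n.choose (j + 1) := by
          exact_mod_cast Nat.choose_succ_succ n j
        have e3 : ((n : ℂ) + 2) * (n + 1).choose j = (n + 2).choose (j + 1) * (j + 1) := by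
          exact_mod_cast Nat.add_one_mul_choose_eq (n + 1) j
        have e4 : ((n : ℂ) + 1) * n.choose j = (n + 1).choose (j + 1) * (j + 1) := by
          exact_mod_cast Nat.add_one_mul_choose_eq n j
        rw [e1] at e3
        rw [e1, Nat.add_sub_cancel]
        push_cast
        linear_combination ((n : ℂ) + j + 3) * e3 - ((n : ℂ) + 1) ^ 2 * e2 - ((n : ℂ) + 1) * e4
    simp only [G, Nat.add_sub_cancel, pow_succ (-1 : ℂ) k]
    push_cast
    linear_combination ((-1) ^ k * p k) * hch - ((-1) ^ k * ((n + 1).choose k : ℂ)) * hp k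
  rw [Finset.sum_congr rfl hG, Finset.sum_range_sub]
  simp [G, hN]

theorem qPoly_eq_binomial_transform (ξ : ℝ) (p : ℕ → ℂ) (hp0 : p 0 = 1)
    (hp : ∀ k : ℕ, ((k : ℂ) + 1) ^ 2 * p (k + 1) =
      ((k : ℂ) ^ 2 + k + (1 / 4 + (ξ : ℂ) ^ 2)) * p k) (n : ℕ) :
    (qPoly n ξ : ℂ) = ∑ k ∈ Finset.range (n + 1), (-1) ^ k * (n.choose k : ℂ) * p k := by
  induction n using Nat.twoStepInduction with
  | zero => simp [qPoly_zero, hp0]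
  | one =>
    have := hp 0
    simp only [Nat.cast_zero, zero_add, hp0] at this
    simp [qPoly_one, Finset.sum_range_succ, hp0]
    linear_combination this
  | more n ih1 ih2 =>
    have h2 : ((n : ℂ) + 2) ^ 2 ≠ 0 := pow_ne_zero _ (by exact_mod_cast (Nat.succ_ne_zero (n + 1)))
    apply mul_left_cancel₀ h2
    rw [binomial_transform_recurrence _ p hp n, ← ih1, ← ih2]
    have h := congrArg (fun x : ℝ => (x : ℂ)) (qPoly_recurrence n ξ)
    push_cast at h
    exact h

/-! ### Beta integrals in exponential form and the integral representation -/

/-- The integrand `x ^ (u - 1) (1 - x) ^ (v - 1) dx` of the Beta integral in the variable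
`x = exp (-t)`. -/
noncomputable def expBeta (u v : ℂ) (t : ℝ) : ℂ :=
  cexp (-u * t) * ((1 - Real.exp (-t) : ℝ) : ℂ) ^ (v - 1)

theorem image_exp_neg_Ioi : (fun t : ℝ => Real.exp (-t)) '' Ioi 0 = Ioo 0 1 := by
  ext x
  constructor
  · rintro ⟨t, ht, rfl⟩
    exact ⟨Real.exp_pos _, by simpa using ht⟩
  · rintro ⟨h0, h1⟩
    exact ⟨-Real.log x, by simpa using Real.log_neg h0 h1, by simp [Real.exp_log h0]⟩

theorem injOn_exp_neg (s : Set ℝ) : InjOn (fun t : ℝ => Real.exp (-t)) s := fun x _ y _ h => by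
  simpa using h

theorem hasDerivWithinAt_exp_neg (s : Set ℝ) (t : ℝ) :
    HasDerivWithinAt (fun t : ℝ => Real.exp (-t)) (-Real.exp (-t)) s t := by
  simpa using ((hasDerivAt_neg t).exp).hasDerivWithinAt

theorem abs_smul_beta_integrand (u v : ℂ) (t : ℝ) :
    |-Real.exp (-t)| • (((Real.exp (-t) : ℝ) : ℂ) ^ (u - 1) *
      (1 - ((Real.exp (-t) : ℝ) : ℂ)) ^ (v - 1)) = expBeta u v t := by
  have h : ((Real.exp (-t) : ℝ) : ℂ) ^ (u - 1) = cexp (-(u - 1) * t) := by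
    rw [ofReal_exp, cpow_def_of_ne_zero (exp_ne_zero _), ← ofReal_exp,
      ← ofReal_log (Real.exp_pos _).le, Real.log_exp]
    push_cast
    congr 1
    ring
  rw [abs_neg, abs_of_pos (Real.exp_pos _), h, expBeta, real_smul, ← mul_assoc, ofReal_exp,
    ← Complex.exp_add, ofReal_sub, ofReal_exp, ofReal_one]
  congr 2
  push_cast
  ring

theorem integrableOn_expBeta {u v : ℂ} (hu : 0 < u.re) (hv : 0 < v.re) :
    IntegrableOn (expBeta u v) (Ioi 0) := by
  have h := (intervalIntegrable_iff_integrableOn_Ioo_of_le zero_le_one).1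
    (betaIntegral_convergent hu hv)
  rw [← image_exp_neg_Ioi, integrableOn_image_iff_integrableOn_abs_deriv_smul measurableSet_Ioi
    (fun t _ => hasDerivWithinAt_exp_neg _ t) (injOn_exp_neg _)] at h
  exact h.congr_fun (fun t _ => abs_smul_beta_integrand u v t) measurableSet_Ioi

theorem integral_expBeta (u v : ℂ) : ∫ t in Ioi (0 : ℝ), expBeta u v t = betaIntegral u v := by
  rw [betaIntegral, intervalIntegral.integral_of_le zero_le_one, integral_Ioc_eq_integral_Ioo,
    ← image_exp_neg_Ioi, integral_image_eq_integral_abs_deriv_smul measurableSet_Ioi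
    (fun t _ => hasDerivWithinAt_exp_neg _ t) (injOn_exp_neg _)]
  exact (setIntegral_congr_fun measurableSet_Ioi
    (fun t _ => abs_smul_beta_integrand u v t)).symm

theorem expBeta_add_natCast (u v : ℂ) (k : ℕ) (t : ℝ) :
    expBeta (u + k) v t = ((Real.exp (-t) : ℝ) : ℂ) ^ k * expBeta u v t := by
  rw [expBeta, expBeta, ← mul_assoc, ofReal_exp, ← Complex.exp_nat_mul, ← Complex.exp_add]
  congr 2
  push_cast
  ring

/-- The additive convolution of two exponential Beta integrands. -/
noncomputable def expBetaConv (u v u' v' : ℂ) (x : ℝ) : ℂ :=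
  ∫ t in (0 : ℝ)..x, expBeta u v t * expBeta u' v' (x - t)

/-- The two shifts contribute `exp (-kt)` and `exp (-k(x - t))`, whose product does not depend on
`t`. Hence products of shifted Beta values are moments of one fixed function. -/
theorem expBetaConv_add_natCast (u v u' v' : ℂ) (k : ℕ) (x : ℝ) :
    expBetaConv (u + k) v (u' + k) v' x =
      ((Real.exp (-x) : ℝ) : ℂ) ^ k * expBetaConv u v u' v' x := by
  rw [expBetaConv, expBetaConv, ← intervalIntegral.integral_const_mul]
  congr 1
  ext t
  rw [expBeta_add_natCast, expBeta_add_natCast]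
  have : Real.exp (-x) = Real.exp (-t) * Real.exp (-(x - t)) := by
    rw [← Real.exp_add]; congr 1; ring
  rw [this, ofReal_mul, mul_pow]
  ring

theorem integrableOn_expBetaConv {u v u' v' : ℂ} (hu : 0 < u.re) (hv : 0 < v.re)
    (hu' : 0 < u'.re) (hv' : 0 < v'.re) : IntegrableOn (expBetaConv u v u' v') (Ioi 0) := by
  have h := (integrable_posConvolution (integrableOn_expBeta hu hv) (integrableOn_expBeta hu' hv')
    (ContinuousLinearMap.mul ℝ ℂ)).integrableOn (s := Ioi 0)
  refine h.congr_fun (fun x hx => ?_) measurableSet_Ioi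
  simp only [posConvolution, indicator_of_mem hx, ContinuousLinearMap.mul_apply', expBetaConv]

theorem integral_expBetaConv {u v u' v' : ℂ} (hu : 0 < u.re) (hv : 0 < v.re)
    (hu' : 0 < u'.re) (hv' : 0 < v'.re) :
    ∫ x in Ioi (0 : ℝ), expBetaConv u v u' v' x = betaIntegral u v * betaIntegral u' v' := by
  have h := integral_posConvolution (integrableOn_expBeta hu hv) (integrableOn_expBeta hu' hv')
    (ContinuousLinearMap.mul ℝ ℂ)
  simp only [ContinuousLinearMap.mul_apply', integral_expBeta] at h
  exact h

/-- Since `a + b = 1`, the denominators `Γ(k + 1)²` of the Beta products supply the `k!²` of the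
solution sequence; the alternating binomial sum of the moments `exp (-kx)` is then `(1 - exp (-x)) ^
n`. -/
theorem qPoly_mul_eq_integral (ξ : ℝ) {a b : ℂ} (ha : a = 1 / 2 + I * ξ) (hb : b = 1 / 2 - I * ξ)
    (n : ℕ) :
    (Gamma a * Gamma b) ^ 2 * qPoly n ξ =
      ∫ x in Ioi (0 : ℝ), ((1 - Real.exp (-x) : ℝ) : ℂ) ^ n * expBetaConv a b b a x := by
  have hare : a.re = 1 / 2 := by simp [ha]
  have hbre : b.re = 1 / 2 := by simp [hb]
  have hab : a + b = 1 := by rw [ha, hb]; ring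
  have hak : ∀ k : ℕ, 0 < (a + k).re := fun k => by
    rw [add_re, hare, natCast_re]; positivity
  have hbk : ∀ k : ℕ, 0 < (b + k).re := fun k => by
    rw [add_re, hbre, natCast_re]; positivity
  have ha0 : 0 < a.re := by rw [hare]; norm_num
  have hb0 : 0 < b.re := by rw [hbre]; norm_num
  have hΓa := Gamma_ne_zero_of_re_pos ha0
  have hΓb := Gamma_ne_zero_of_re_pos hb0
  have hmom : ∀ k : ℕ, betaIntegral (a + k) b * betaIntegral (b + k) a =
      Gamma a * Gamma b * (Gamma (a + k) * Gamma (b + k)) / (k.factorial : ℂ) ^ 2 := by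
    intro k
    rw [betaIntegral_eq_Gamma_mul_div _ _ (hak k) hb0, betaIntegral_eq_Gamma_mul_div _ _ (hbk k) ha0,
      show a + k + b = k + 1 by rw [← hab]; ring, show b + k + a = k + 1 by rw [← hab]; ring,
      Gamma_nat_eq_factorial]
    have : (k.factorial : ℂ) ≠ 0 := by exact_mod_cast k.factorial_ne_zero
    field_simp
  have hq := qPoly_eq_binomial_transform ξ
    (fun k => betaIntegral (a + k) b * betaIntegral (b + k) a / (Gamma a * Gamma b) ^ 2)
    (by simp only [hmom]; simp; field_simp)
    (by
      intro k
      simp only [hmom]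
      have hf : (k.factorial : ℂ) ≠ 0 := by exact_mod_cast k.factorial_ne_zero
      have hk : (k : ℂ) + 1 ≠ 0 := by exact_mod_cast k.succ_ne_zero
      have e1 : Gamma (a + (k + 1 : ℕ)) = (a + k) * Gamma (a + k) := by
        rw [← Gamma_add_one _ (fun h => by have := hak k; rw [h] at this; simp at this)]
        congr 1; push_cast; ring
      have e2 : Gamma (b + (k + 1 : ℕ)) = (b + k) * Gamma (b + k) := by
        rw [← Gamma_add_one _ (fun h => by have := hbk k; rw [h] at this; simp at this)]
        congr 1; push_cast; ring
      have e3 : (a + k) * (b + k) = (k : ℂ) ^ 2 + k + (1 / 4 + (ξ : ℂ) ^ 2) := by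
        rw [ha, hb]
        linear_combination (-(ξ : ℂ) ^ 2) * I_sq
      rw [e1, e2, ← e3, Nat.factorial_succ]
      push_cast
      field_simp) n
  rw [hq]
  have hint : ∀ k : ℕ, IntegrableOn (expBetaConv (a + k) b (b + k) a) (Ioi 0) := fun k =>
    integrableOn_expBetaConv (hak k) hb0 (hbk k) ha0
  have hpt : ∀ x : ℝ, ((1 - Real.exp (-x) : ℝ) : ℂ) ^ n * expBetaConv a b b a x =
      ∑ k ∈ Finset.range (n + 1), ((-1) ^ k * (n.choose k : ℂ)) *
        expBetaConv (a + k) b (b + k) a x := by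
    intro x
    simp only [expBetaConv_add_natCast]
    rw [ofReal_sub, sub_eq_neg_add, ofReal_one, add_pow, Finset.sum_mul]
    refine Finset.sum_congr rfl fun k _ => ?_
    rw [one_pow, neg_pow]
    ring
  simp only [hpt]
  rw [integral_finsetSum _ (fun k _ => (hint k).const_mul _), Finset.mul_sum]
  refine Finset.sum_congr rfl fun k _ => ?_
  rw [integral_const_mul, integral_expBetaConv (hak k) hb0 (hbk k) ha0]
  field_simp

/-! ### Asymptotics of the convolution for large argument -/

theorem one_sub_exp_neg_pos {t : ℝ} (ht : 0 < t) : 0 < 1 - Real.exp (-t) := by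
  simpa using ht

theorem norm_expBeta (u v : ℂ) {t : ℝ} (ht : 0 < t) :
    ‖expBeta u v t‖ = Real.exp (-u.re * t) * (1 - Real.exp (-t)) ^ (v.re - 1) := by
  rw [expBeta, norm_mul, norm_exp, norm_cpow_eq_rpow_re_of_pos (one_sub_exp_neg_pos ht)]
  simp

/-- Mean value inequality on `[y, 1]`: as `c.re ≤ 1`, the bound on the derivative is worst at `y`.
-/
theorem norm_ofReal_cpow_sub_one_le {c : ℂ} (hc : c.re ≤ 1) {y : ℝ} (hy : 0 < y) (hy1 : y ≤ 1) :
    ‖(y : ℂ) ^ c - 1‖ ≤ ‖c‖ * y ^ (c.re - 1) * (1 - y) := by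
  have hd : ∀ x ∈ Icc y 1, HasDerivWithinAt (fun x : ℝ => (x : ℂ) ^ c) (c * (x : ℂ) ^ (c - 1))
      (Icc y 1) x := by
    intro x hx
    have hx0 : 0 < x := hy.trans_le hx.1
    have h := (HasDerivAt.cpow_const (c := c) (hasDerivAt_id (x : ℂ)) (Or.inl (by simpa using hx0)))
    simpa using h.comp_ofReal.hasDerivWithinAt
  have hb : ∀ x ∈ Icc y 1, ‖c * (x : ℂ) ^ (c - 1)‖ ≤ ‖c‖ * y ^ (c.re - 1) := by
    intro x hx
    have hx0 : 0 < x := hy.trans_le hx.1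
    rw [norm_mul, norm_cpow_eq_rpow_re_of_pos hx0]
    gcongr
    exact Real.rpow_le_rpow_of_nonpos hy hx.1 (by simpa using hc)
  have h := (convex_Icc y 1).norm_image_sub_le_of_norm_hasDerivWithin_le hd hb
    (right_mem_Icc.2 hy1) (left_mem_Icc.2 hy1)
  simpa [abs_of_nonpos (sub_nonpos.2 hy1)] using h

theorem conj_expBeta (u v : ℂ) {t : ℝ} (ht : 0 ≤ t) :
    (starRingEnd ℂ) (expBeta u v t) = expBeta ((starRingEnd ℂ) u) ((starRingEnd ℂ) v) t := by
  have h0 : 0 ≤ 1 - Real.exp (-t) := by simpa using ht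
  have harg : ((1 - Real.exp (-t) : ℝ) : ℂ).arg ≠ Real.pi := by
    rw [arg_ofReal_of_nonneg h0]; exact Real.pi_ne_zero.symm
  have h := cpow_conj _ (v - 1) harg
  rw [conj_ofReal, map_sub, map_one] at h
  rw [expBeta, expBeta, map_mul, ← exp_conj, h]
  simp

theorem continuousAt_expBeta (u v : ℂ) {t : ℝ} (ht : 0 < t) : ContinuousAt (expBeta u v) t := by
  unfold expBeta
  refine ContinuousAt.mul (by fun_prop) (ContinuousAt.cpow (by fun_prop) (by fun_prop) ?_)
  exact ofReal_mem_slitPlane.2 (one_sub_exp_neg_pos ht)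

theorem intervalIntegrable_expBeta (u : ℂ) {v : ℂ} (hv : 0 < v.re) {T : ℝ} (hT : 0 ≤ T) :
    IntervalIntegrable (expBeta u v) volume 0 T := by
  have h1 : IntervalIntegrable (expBeta 1 v) volume 0 T :=
    (intervalIntegrable_iff_integrableOn_Ioc_of_le hT).2
      ((integrableOn_expBeta (by simp) hv).mono_set Ioc_subset_Ioi_self)
  -- On a bounded interval the exponential factor is harmless, so `u` needs no positive real part;
  -- it is used with `u = -1` and with `u = 1 - 2 * b`, whose real part is `0`.
  have h2 := h1.continuousOn_mul (g := fun t : ℝ => cexp ((1 - u) * t))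
    (Continuous.continuousOn (by fun_prop))
  refine h2.congr (fun t _ => ?_)
  simp only [expBeta]
  rw [← mul_assoc, ← Complex.exp_add]
  congr 2
  ring

theorem intervalIntegrable_expBeta_mul (u u' : ℂ) {v v' : ℂ} (hv : 0 < v.re)
    {T x : ℝ} (hT : 0 ≤ T) (hTx : T < x) :
    IntervalIntegrable (fun t => expBeta u v t * expBeta u' v' (x - t)) volume 0 T := by
  refine (intervalIntegrable_expBeta u hv hT).mul_continuousOn ?_
  intro t ht
  rw [uIcc_of_le hT] at ht
  refine ContinuousAt.continuousWithinAt ?_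
  exact ContinuousAt.comp (g := expBeta u' v') (continuousAt_expBeta _ _ (by linarith [ht.2]))
    (by fun_prop)

/-- The convolution of a Beta integrand with its conjugate is twice the real part of half of it. -/
theorem expBetaConv_conj_re (u : ℂ) {v : ℂ} (hv : 0 < v.re) {x : ℝ} (hx : 0 < x) :
    (expBetaConv u v ((starRingEnd ℂ) u) ((starRingEnd ℂ) v) x).re =
      2 * (∫ t in (0 : ℝ)..x / 2,
        expBeta u v t * expBeta ((starRingEnd ℂ) u) ((starRingEnd ℂ) v) (x - t)).re := by
  set f : ℝ → ℂ := fun t =>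
    expBeta u v t * expBeta ((starRingEnd ℂ) u) ((starRingEnd ℂ) v) (x - t) with hf
  have hi : IntervalIntegrable f volume 0 (x / 2) :=
    intervalIntegrable_expBeta_mul _ _ hv (by linarith) (by linarith)
  -- The reflection `t ↦ x - t` swaps the two factors up to conjugation, so the two halves of the
  -- integral are conjugate.
  have hsymm : ∀ t ∈ Icc 0 x, f (x - t) = (starRingEnd ℂ) (f t) := by
    intro t ht
    simp only [hf, map_mul, sub_sub_cancel]
    rw [conj_expBeta _ _ ht.1, conj_expBeta _ _ (sub_nonneg.2 ht.2), conj_conj, conj_conj, mul_comm]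
  have hconj : ∫ t in (0 : ℝ)..x / 2, f (x - t) = (starRingEnd ℂ) (∫ t in (0 : ℝ)..x / 2, f t) := by
    rw [← intervalIntegral.intervalIntegral_conj]
    refine intervalIntegral.integral_congr fun t ht => hsymm t ?_
    rw [uIcc_of_le (by linarith)] at ht
    exact ⟨ht.1, by linarith [ht.2]⟩
  have hi2 : IntervalIntegrable f volume (x / 2) x := by
    have h := (((intervalIntegrable_expBeta_mul ((starRingEnd ℂ) u) u (v' := v)
      (by simpa using hv : 0 < ((starRingEnd ℂ) v).re)
      (by linarith : 0 ≤ x / 2) (by linarith : x / 2 < x)).comp_sub_left x).symm)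
    rw [sub_half, sub_zero] at h
    refine h.congr fun t _ => ?_
    simp only [hf, sub_sub_cancel, mul_comm]
  have h2 : ∫ t in (x / 2)..x, f t = (starRingEnd ℂ) (∫ t in (0 : ℝ)..x / 2, f t) := by
    rw [← hconj, intervalIntegral.integral_comp_sub_left, sub_half, sub_zero]
  rw [expBetaConv, ← intervalIntegral.integral_add_adjacent_intervals hi hi2, h2]
  simp
  ring

/-- The integrand is dominated by the derivative of `2 e^t (1 - e^{-t})^{1/2}`; with `q = (1 -
e^{-t})^{-1/2}` the difference is `q (e^t - 1) ≥ 0`. -/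
theorem integral_exp_mul_rpow_le {T : ℝ} (hT : 0 < T) :
    ∫ t in (0 : ℝ)..T, Real.exp t * (1 - Real.exp (-t)) ^ (-(1 / 2) : ℝ) ≤
      2 * Real.exp T * (1 - Real.exp (-T)) ^ (1 / 2 : ℝ) := by
  have hint : IntervalIntegrable (fun t => Real.exp t * (1 - Real.exp (-t)) ^ (-(1 / 2) : ℝ))
      volume 0 T := by
    refine (intervalIntegrable_expBeta (-1) (v := 1 / 2) (by simp) hT.le).norm.congr fun t ht => ?_
    rw [uIoc_of_le hT.le] at ht
    simp only [norm_expBeta _ _ ht.1]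
    norm_num
  have h := intervalIntegral.integral_le_sub_of_hasDeriv_right_of_le
    (g := fun t => 2 * Real.exp t * (1 - Real.exp (-t)) ^ (1 / 2 : ℝ))
    (g' := fun t => 2 * Real.exp t * (1 - Real.exp (-t)) ^ (1 / 2 : ℝ) +
      2 * Real.exp t * (Real.exp (-t) * (1 / 2) * (1 - Real.exp (-t)) ^ (1 / 2 - 1 : ℝ))) hT.le
    (by
      refine Continuous.continuousOn (Continuous.mul (by fun_prop) ?_)
      exact Continuous.rpow_const (by fun_prop) (fun _ => Or.inr (by norm_num)))
    (by
      intro t ht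
      have h1 : HasDerivAt (fun t : ℝ => 1 - Real.exp (-t)) (Real.exp (-t)) t := by
        simpa using ((hasDerivAt_neg t).exp).const_sub 1
      have h2 := h1.rpow_const (p := 1 / 2) (Or.inl (one_sub_exp_neg_pos ht.1).ne')
      exact (((Real.hasDerivAt_exp t).const_mul 2).mul h2).hasDerivWithinAt)
    ((intervalIntegrable_iff_integrableOn_Icc_of_le hT.le).1 hint)
    (by
      intro t ht
      have hy := one_sub_exp_neg_pos ht.1
      have e1 : (1 - Real.exp (-t)) ^ (1 / 2 : ℝ) =
          (1 - Real.exp (-t)) ^ (-(1 / 2) : ℝ) * (1 - Real.exp (-t)) := by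
        rw [← Real.rpow_add_one hy.ne']; norm_num
      have e2 : Real.exp t * Real.exp (-t) = 1 := by rw [← Real.exp_add]; simp
      have e3 : (1 : ℝ) ≤ Real.exp t := Real.one_le_exp ht.1.le
      have e4 : 0 ≤ (1 - Real.exp (-t)) ^ (-(1 / 2) : ℝ) := Real.rpow_nonneg hy.le _
      rw [show (1 / 2 - 1 : ℝ) = -(1 / 2) by norm_num, e1]
      set q := (1 - Real.exp (-t)) ^ (-(1 / 2) : ℝ)
      have : 2 * Real.exp t * (q * (1 - Real.exp (-t))) +
          2 * Real.exp t * (Real.exp (-t) * (1 / 2) * q) - Real.exp t * q =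
          q * (Real.exp t - 1) := by linear_combination (-q) * e2
      nlinarith [mul_nonneg e4 (sub_nonneg.2 e3)])
  simpa using h

/-- The error of dropping the factor `(1 - exp (-(x - t))) ^ (-b)` from half of the convolution. -/
theorem norm_half_conv_sub_le {b : ℂ} (hb : b.re = 1 / 2) {x : ℝ} (hx : 0 < x) :
    ‖(∫ t in (0 : ℝ)..x / 2, expBeta (1 - b) b t * expBeta b (1 - b) (x - t)) -
        cexp (-b * x) * ∫ t in (0 : ℝ)..x / 2, expBeta (1 - 2 * b) b t‖ ≤
      2 * ‖b‖ * (Real.exp (-x) / (1 - Real.exp (-(x / 2)))) := by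
  have hT : 0 < x / 2 := by linarith
  have hw := one_sub_exp_neg_pos hT
  set w := Real.exp (-(x / 2)) with hwdef
  have hv : 0 < b.re := by rw [hb]; norm_num
  rw [← intervalIntegral.integral_const_mul, ← intervalIntegral.integral_sub
    (intervalIntegrable_expBeta_mul _ _ hv hT.le (by linarith))
    ((intervalIntegrable_expBeta _ hv hT.le).const_mul _)]
  have hnb : ‖cexp (-b * x)‖ = w := by
    rw [norm_exp, hwdef]
    congr 1
    simp [hb]
    ring
  -- The mean value bound is applied with `y = 1 - exp (-(x - t))`: there `y ≥ 1 - w` because `t ≤ x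
  -- / 2`, and `1 - y = exp (-x) * exp t`.
  have hpt : ∀ t ∈ Ioc 0 (x / 2), ‖expBeta (1 - b) b t * expBeta b (1 - b) (x - t) -
      cexp (-b * x) * expBeta (1 - 2 * b) b t‖ ≤
      (‖b‖ * w * Real.exp (-x) * (1 - w) ^ (-(3 / 2) : ℝ)) *
        (Real.exp t * (1 - Real.exp (-t)) ^ (-(1 / 2) : ℝ)) := by
    intro t ht
    have hxt : 0 < x - t := by linarith [ht.2]
    have hz := one_sub_exp_neg_pos hxt
    have hzw : 1 - w ≤ 1 - Real.exp (-(x - t)) := by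
      have : Real.exp (-(x - t)) ≤ w := Real.exp_le_exp.2 (by linarith [ht.2])
      linarith
    have e : expBeta (1 - b) b t * expBeta b (1 - b) (x - t) -
      cexp (-b * x) * expBeta (1 - 2 * b) b t = cexp (-b * x) * expBeta (1 - 2 * b) b t *
        (((1 - Real.exp (-(x - t)) : ℝ) : ℂ) ^ (-b) - 1) := by
      have h1 : cexp (-(1 - b) * t) * cexp (-b * (x - t : ℝ)) =
          cexp (-b * x) * cexp (-(1 - 2 * b) * t) := by
        rw [← Complex.exp_add, ← Complex.exp_add]; congr 1; push_cast; ring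
      simp only [expBeta]
      rw [show 1 - b - 1 = -b by ring]
      linear_combination (((1 - Real.exp (-t) : ℝ) : ℂ) ^ (b - 1) *
        ((1 - Real.exp (-(x - t)) : ℝ) : ℂ) ^ (-b)) * h1
    have hm := norm_ofReal_cpow_sub_one_le (c := -b) (by simp [hb]; norm_num) hz
      (by linarith [Real.exp_pos (-(x - t))])
    have hm2 : (1 - Real.exp (-(x - t))) ^ ((-b).re - 1) ≤ (1 - w) ^ (-(3 / 2) : ℝ) := by
      rw [neg_re, hb, show (-(1 / 2) - 1 : ℝ) = -(3 / 2) by norm_num]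
      exact Real.rpow_le_rpow_of_nonpos hw hzw (by norm_num)
    rw [e, norm_mul, norm_mul, hnb, norm_expBeta _ _ ht.1]
    have h2 : -(1 - 2 * b).re * t = 0 := by simp [hb]
    rw [h2, Real.exp_zero, hb, one_mul, show (1 / 2 - 1 : ℝ) = -(1 / 2) by norm_num]
    rw [norm_neg, sub_sub_cancel, show -(x - t) = -x + t by ring, Real.exp_add] at hm
    rw [show -(x - t) = -x + t by ring, Real.exp_add] at hm2 ⊢
    calc w * (1 - Real.exp (-t)) ^ (-(1 / 2) : ℝ) *
          ‖((1 - Real.exp (-x) * Real.exp t : ℝ) : ℂ) ^ (-b) - 1‖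
        ≤ w * (1 - Real.exp (-t)) ^ (-(1 / 2) : ℝ) *
          (‖b‖ * (1 - w) ^ (-(3 / 2) : ℝ) * (Real.exp (-x) * Real.exp t)) := by
          have := Real.rpow_nonneg (one_sub_exp_neg_pos ht.1).le (-(1 / 2))
          have hw0 : 0 < w := Real.exp_pos _
          gcongr
          refine hm.trans ?_
          gcongr
      _ = _ := by ring
  have hint : IntervalIntegrable (fun t => Real.exp t * (1 - Real.exp (-t)) ^ (-(1 / 2) : ℝ))
      volume 0 (x / 2) := by
    refine (intervalIntegrable_expBeta (-1) (v := 1 / 2) (by simp) hT.le).norm.congr fun t ht => ?_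
    rw [uIoc_of_le hT.le] at ht
    simp only [norm_expBeta _ _ ht.1]
    norm_num
  refine (intervalIntegral.norm_integral_le_of_norm_le hT.le
    (Filter.Eventually.of_forall hpt) (hint.const_mul _)).trans ?_
  rw [intervalIntegral.integral_const_mul]
  refine (mul_le_mul_of_nonneg_left (integral_exp_mul_rpow_le hT)
    (by have := Real.rpow_nonneg hw.le (-(3 / 2)); positivity)).trans (le_of_eq ?_)
  have e1 : (1 - w) ^ (-(3 / 2) : ℝ) * (1 - w) ^ (1 / 2 : ℝ) = (1 - w)⁻¹ := by
    rw [← Real.rpow_add hw, ← Real.rpow_neg_one]; norm_num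
  have e2 : w * Real.exp (x / 2) = 1 := by rw [hwdef, ← Real.exp_add]; simp
  rw [div_eq_mul_inv (Real.exp (-x)), ← e1]
  linear_combination (2 * ‖b‖ * Real.exp (-x) * (1 - w) ^ (-(3 / 2) : ℝ) *
    (1 - w) ^ (1 / 2 : ℝ)) * e2

/-- As `(1 - 2b).re = 0`, the integrand on the left does not decay. Integrating by parts gains a
factor `exp (-t)`, at the price of `1 - 2b = 2iξ`; this is the source of `1/ξ` in the theorem. The
boundary term at `0` vanishes because `b.re > 0`. -/
theorem integral_expBeta_integration_by_parts {b : ℂ} (hb : b.re = 1 / 2) {T : ℝ} (hT : 0 < T) :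
    (1 - 2 * b) * ∫ t in (0 : ℝ)..T, expBeta (1 - 2 * b) b t =
      (1 - b) * (∫ t in (0 : ℝ)..T, expBeta (2 - 2 * b) b t) -
        cexp (-(1 - 2 * b) * T) * ((1 - Real.exp (-T) : ℝ) : ℂ) ^ b := by
  have hv : 0 < b.re := by rw [hb]; norm_num
  have hb0 : b ≠ 0 := fun h => by rw [h] at hv; simp at hv
  have i1 := intervalIntegrable_expBeta (2 - 2 * b) hv hT.le
  have i2 := intervalIntegrable_expBeta (1 - 2 * b) hv hT.le
  have h := intervalIntegral.integral_eq_sub_of_hasDerivAt_of_le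
    (f := fun t : ℝ => cexp (-(1 - 2 * b) * t) * ((1 - Real.exp (-t) : ℝ) : ℂ) ^ b)
    (f' := fun t => (1 - b) * expBeta (2 - 2 * b) b t - (1 - 2 * b) * expBeta (1 - 2 * b) b t) hT.le
    (by
      refine ContinuousOn.mul (Continuous.continuousOn (by fun_prop)) ?_
      intro t ht
      refine ContinuousAt.continuousWithinAt ?_
      refine ContinuousAt.comp (f := fun t : ℝ => ((1 - Real.exp (-t) : ℝ) : ℂ))
        (g := fun z : ℂ => z ^ b) ?_ (by fun_prop)
      refine continuousAt_cpow_const_of_re_pos (Or.inl ?_) hv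
      rw [ofReal_re]
      simpa using ht.1)
    (by
      intro t ht
      have hy := one_sub_exp_neg_pos ht.1
      have h1 : HasDerivAt (fun t : ℝ => ((1 - Real.exp (-t) : ℝ) : ℂ))
          ((Real.exp (-t) : ℝ) : ℂ) t := by
        have : HasDerivAt (fun t : ℝ => 1 - Real.exp (-t)) (Real.exp (-t)) t := by
          simpa using ((hasDerivAt_neg t).exp).const_sub 1
        exact this.ofReal_comp
      have h2 := ((HasDerivAt.cpow_const (c := b) (hasDerivAt_id ((1 - Real.exp (-t) : ℝ) : ℂ))
        (ofReal_mem_slitPlane.2 hy))).comp t h1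
      have h3 : HasDerivAt (fun t : ℝ => cexp (-(1 - 2 * b) * t))
          (cexp (-(1 - 2 * b) * t) * -(1 - 2 * b)) t := by
        have := ((hasDerivAt_id (t : ℂ)).const_mul (-(1 - 2 * b))).cexp.comp_ofReal
        simpa using this
      refine (h3.mul h2).congr_deriv ?_
      have e1 : ((1 - Real.exp (-t) : ℝ) : ℂ) ^ b =
          ((1 - Real.exp (-t) : ℝ) : ℂ) ^ (b - 1) * (1 - (Real.exp (-t) : ℝ)) := by
        have hne : ((1 - Real.exp (-t) : ℝ) : ℂ) ≠ 0 := ofReal_ne_zero.2 hy.ne'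
        conv_lhs => rw [show b = (b - 1) + 1 by ring, cpow_add _ _ hne, cpow_one]
        push_cast
        rfl
      have e2 : cexp (-(2 - 2 * b) * t) = cexp (-(1 - 2 * b) * t) * (Real.exp (-t) : ℝ) := by
        rw [ofReal_exp, ← Complex.exp_add]; congr 1; push_cast; ring
      simp only [expBeta, e2, Function.comp_def, id]
      rw [e1]
      ring)
    ((i1.const_mul _).sub (i2.const_mul _))
  rw [intervalIntegral.integral_sub (i1.const_mul _) (i2.const_mul _),
    intervalIntegral.integral_const_mul, intervalIntegral.integral_const_mul] at h
  simp only [neg_zero, Real.exp_zero, sub_self, ofReal_zero, zero_cpow hb0, mul_zero, sub_zero] at h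
  linear_combination -h

theorem norm_tail_integral_expBeta_le {b : ℂ} (hb : b.re = 1 / 2) {T : ℝ} (hT : 0 < T) :
    ‖betaIntegral (2 - 2 * b) b - ∫ t in (0 : ℝ)..T, expBeta (2 - 2 * b) b t‖ ≤
      Real.exp (-T) * (1 - Real.exp (-T)) ^ (-(1 / 2) : ℝ) := by
  have hv : 0 < b.re := by rw [hb]; norm_num
  have hu : (2 - 2 * b).re = 1 := by simp [hb]; norm_num
  have hi := integrableOn_expBeta (u := 2 - 2 * b) (by rw [hu]; norm_num) hv
  have hi2 : IntegrableOn (expBeta (2 - 2 * b) b) (Ioi T) := hi.mono_set (Ioi_subset_Ioi hT.le)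
  have hsplit := intervalIntegral.integral_interval_add_Ioi hi hi2
  rw [integral_expBeta] at hsplit
  rw [← hsplit, add_sub_cancel_left]
  have hpt : ∀ t ∈ Ioi T, ‖expBeta (2 - 2 * b) b t‖ ≤
      (1 - Real.exp (-T)) ^ (-(1 / 2) : ℝ) * Real.exp (-t) := by
    intro t ht
    rw [norm_expBeta _ _ (hT.trans ht), hu, hb, neg_one_mul, mul_comm,
      show (1 / 2 - 1 : ℝ) = -(1 / 2) by norm_num]
    gcongr ?_ * _
    refine Real.rpow_le_rpow_of_nonpos (one_sub_exp_neg_pos hT) ?_ (by norm_num)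
    have : Real.exp (-t) ≤ Real.exp (-T) := Real.exp_le_exp.2 (by linarith [mem_Ioi.1 ht])
    linarith
  refine (norm_integral_le_of_norm_le ((integrableOn_exp_neg_Ioi T).const_mul _)
    ((ae_restrict_iff' measurableSet_Ioi).2 (Filter.Eventually.of_forall hpt))).trans ?_
  rw [integral_const_mul, integral_exp_neg_Ioi, mul_comm]

/-- Multiplied by `exp (-bx)`, the boundary term of the integration by parts is `exp (-x/2)` up to
the allowed error. It is as large as the main term, but real, so it drops out of imaginary parts. -/
theorem norm_half_conv_sub_main_le {b : ℂ} (hb : b.re = 1 / 2) {x : ℝ} (hx : 0 < x) :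
    ‖(1 - 2 * b) * (∫ t in (0 : ℝ)..x / 2, expBeta (1 - b) b t * expBeta b (1 - b) (x - t)) -
        ((1 - b) * betaIntegral (2 - 2 * b) b * cexp (-b * x) - (Real.exp (-(x / 2)) : ℝ))‖ ≤
      (2 * ‖1 - 2 * b‖ * ‖b‖ + ‖1 - b‖ + ‖b‖) *
        (Real.exp (-x) / (1 - Real.exp (-(x / 2)))) := by
  have hT : 0 < x / 2 := by linarith
  have hw := one_sub_exp_neg_pos hT
  have h1 := norm_half_conv_sub_le hb hx
  have h2 := integral_expBeta_integration_by_parts hb hT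
  have h3 := norm_tail_integral_expBeta_le hb hT
  have h4 := norm_ofReal_cpow_sub_one_le (c := b) (by rw [hb]; norm_num) hw
    (by linarith [Real.exp_pos (-(x / 2))])
  rw [hb, sub_sub_cancel, show (1 / 2 - 1 : ℝ) = -(1 / 2) by norm_num] at h4
  have hnb : ‖cexp (-b * x)‖ = Real.exp (-(x / 2)) := by
    rw [norm_exp]
    congr 1
    simp [hb]
    ring
  have hnu : ‖cexp (-(1 - 2 * b) * (x / 2 : ℝ))‖ = 1 := by
    rw [norm_exp]
    simp [hb]
  have hprod : cexp (-b * x) * cexp (-(1 - 2 * b) * (x / 2 : ℝ)) =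
      (Real.exp (-(x / 2)) : ℝ) := by
    rw [ofReal_exp, ← Complex.exp_add]
    congr 1
    push_cast
    ring
  have hsq : Real.exp (-x) = Real.exp (-(x / 2)) * Real.exp (-(x / 2)) := by
    rw [← Real.exp_add]; congr 1; ring
  have hrp : (1 - Real.exp (-(x / 2))) ^ (-(1 / 2) : ℝ) ≤ (1 - Real.exp (-(x / 2)))⁻¹ := by
    rw [← Real.rpow_neg_one]
    exact Real.rpow_le_rpow_of_exponent_ge hw (by linarith [Real.exp_pos (-(x / 2))]) (by norm_num)
  set w := Real.exp (-(x / 2))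
  have hw0 : 0 < w := Real.exp_pos _
  set Ψ := ∫ t in (0 : ℝ)..x / 2, expBeta (1 - b) b t * expBeta b (1 - b) (x - t)
  set Φ := ∫ t in (0 : ℝ)..x / 2, expBeta (1 - 2 * b) b t
  set Φ' := ∫ t in (0 : ℝ)..x / 2, expBeta (2 - 2 * b) b t
  set B := betaIntegral (2 - 2 * b) b
  have hdecomp : (1 - 2 * b) * Ψ - ((1 - b) * B * cexp (-b * x) - (w : ℝ)) =
      (1 - 2 * b) * (Ψ - cexp (-b * x) * Φ) - cexp (-b * x) * ((1 - b) * (B - Φ')) -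
        cexp (-b * x) * (cexp (-(1 - 2 * b) * (x / 2 : ℝ)) * (((1 - w : ℝ) : ℂ) ^ b - 1)) := by
    linear_combination cexp (-b * x) * h2 - hprod
  rw [hdecomp]
  refine (norm_sub_le _ _).trans ((add_le_add_left (norm_sub_le _ _) _).trans ?_)
  simp only [norm_mul, hnb, hnu, one_mul]
  have b1 : ‖1 - 2 * b‖ * ‖Ψ - cexp (-b * x) * Φ‖ ≤
      ‖1 - 2 * b‖ * (2 * ‖b‖ * (Real.exp (-x) / (1 - w))) := by gcongr
  have b2 : w * (‖1 - b‖ * ‖B - Φ'‖) ≤ w * (‖1 - b‖ * (w * (1 - w)⁻¹)) := by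
    gcongr
    exact h3.trans (by gcongr)
  have b3 : w * ‖((1 - w : ℝ) : ℂ) ^ b - 1‖ ≤ w * (‖b‖ * (1 - w)⁻¹ * w) := by
    gcongr
    exact h4.trans (by gcongr)
  rw [hsq, div_eq_mul_inv] at b1 ⊢
  linarith

/-! ### Comparison of `B(b, n + 1)` with `n^{-b} Γ(b)` -/

/-- For `u < 1` the upper bound is `1 - u ≤ e^{-u}`, and the lower one combines Bernoulli for `(1 -
u²)^n` with `(1 + u)^n ≤ e^{nu}`. For `u ≥ 1` already `n u² ≥ 1`. -/
theorem abs_indicator_one_sub_pow_sub_exp_le {n : ℕ} (hn : 1 ≤ n) {u : ℝ} (hu : 0 < u) :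
    |(Iio (1 : ℝ)).indicator (fun u => (1 - u) ^ n) u - Real.exp (-(n * u))| ≤
      n * u ^ 2 * Real.exp (-(n * u)) := by
  have hn' : (1 : ℝ) ≤ n := by exact_mod_cast hn
  have he := Real.exp_pos (-(n * u))
  rcases lt_or_ge u 1 with h1 | h1
  · rw [indicator_of_mem (mem_Iio.2 h1)]
    have hup : (1 - u) ^ n ≤ Real.exp (-(n * u)) := by
      have := pow_le_pow_left₀ (by linarith) (Real.one_sub_le_exp_neg u) n
      rwa [← Real.exp_nat_mul, mul_neg] at this
    have hlow : (1 - n * u ^ 2) * Real.exp (-(n * u)) ≤ (1 - u) ^ n := by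
      have h2 : 1 - n * u ^ 2 ≤ (1 - u ^ 2) ^ n := by
        have := one_add_mul_le_pow (a := -u ^ 2) (by nlinarith) n
        rw [← sub_eq_add_neg] at this
        linarith
      have h3 : (1 + u) ^ n ≤ Real.exp (n * u) := by
        have := pow_le_pow_left₀ (by linarith) (Real.add_one_le_exp u) n
        rwa [← Real.exp_nat_mul, add_comm] at this
      have h4 : (1 - u ^ 2) ^ n = (1 - u) ^ n * (1 + u) ^ n := by
        rw [← mul_pow]; congr 1; ring
      have h5 : (1 - u) ^ n * (1 + u) ^ n ≤ (1 - u) ^ n * Real.exp (n * u) := by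
        have : 0 ≤ 1 - u := by linarith
        gcongr
      have h6 : Real.exp (n * u) * Real.exp (-(n * u)) = 1 := by rw [← Real.exp_add]; simp
      calc (1 - n * u ^ 2) * Real.exp (-(n * u))
          ≤ (1 - u) ^ n * Real.exp (n * u) * Real.exp (-(n * u)) := by gcongr; linarith
        _ = _ := by rw [mul_assoc, h6, mul_one]
    rw [abs_le]
    constructor <;> nlinarith [mul_nonneg (mul_nonneg (by linarith : (0 : ℝ) ≤ n) (sq_nonneg u)) he.le]
  · rw [indicator_of_notMem (by simpa using h1), zero_sub, abs_neg, abs_of_pos he]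
    have : (1 : ℝ) ≤ n * u ^ 2 := by nlinarith
    nlinarith

theorem integrableOn_rpow_mul_exp_neg_mul {s r : ℝ} (hs : -1 < s) (hr : 0 < r) :
    IntegrableOn (fun u : ℝ => u ^ s * Real.exp (-(r * u))) (Ioi 0) := by
  have h := integrableOn_rpow_mul_exp_neg_mul_rpow hs one_pos hr
  simpa only [Real.rpow_one, neg_mul] using h

theorem norm_betaIntegral_sub_Gamma_le {b : ℂ} (hb : b.re = 1 / 2) {n : ℕ} (hn : 1 ≤ n) :
    ‖betaIntegral b (n + 1) - (n : ℂ) ^ (-b) * Gamma b‖ ≤ Real.Gamma (5 / 2) / n := by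
  have hn0 : (0 : ℝ) < n := by exact_mod_cast hn
  have hn1 : (1 : ℝ) ≤ n := by exact_mod_cast hn
  have hv : 0 < b.re := by rw [hb]; norm_num
  set F : ℝ → ℂ := fun u => (u : ℂ) ^ (b - 1) *
    (((Iio (1 : ℝ)).indicator (fun u => (1 - u) ^ n) u : ℝ) : ℂ) with hF
  have hFind : ∀ u : ℝ, F u = (Iio (1 : ℝ)).indicator
      (fun u : ℝ => (u : ℂ) ^ (b - 1) * (1 - (u : ℂ)) ^ ((n : ℂ) + 1 - 1)) u := by
    intro u
    simp only [hF, add_sub_cancel_right, cpow_natCast]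
    by_cases h : u ∈ Iio (1 : ℝ)
    · simp [indicator_of_mem h]
    · simp [indicator_of_notMem h]
  have hset : Iio (1 : ℝ) ∩ Ioi 0 = Ioo 0 1 := by rw [inter_comm, Ioi_inter_Iio]
  have hB : betaIntegral b (n + 1) = ∫ u in Ioi (0 : ℝ), F u := by
    simp only [hFind]
    rw [integral_indicator measurableSet_Iio, Measure.restrict_restrict measurableSet_Iio, hset,
      betaIntegral, intervalIntegral.integral_of_le zero_le_one, integral_Ioc_eq_integral_Ioo]
  have hBi : IntegrableOn F (Ioi 0) := by
    rw [funext hFind, IntegrableOn, integrable_indicator_iff measurableSet_Iio, IntegrableOn,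
      Measure.restrict_restrict measurableSet_Iio, hset]
    exact (intervalIntegrable_iff_integrableOn_Ioo_of_le zero_le_one).1
      (betaIntegral_convergent hv (by simp; positivity))
  have hG : (n : ℂ) ^ (-b) * Gamma b =
      ∫ u in Ioi (0 : ℝ), (u : ℂ) ^ (b - 1) * ((Real.exp (-(n * u)) : ℝ) : ℂ) := by
    have h := integral_cpow_mul_exp_neg_mul_Ioi hv hn0
    rw [one_div, ofReal_natCast, inv_cpow _ _ (by rw [natCast_arg]; exact Real.pi_ne_zero.symm),
      ← cpow_neg] at h
    rw [← h]
    push_cast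
    rfl
  have hGi : IntegrableOn (fun u : ℝ => (u : ℂ) ^ (b - 1) * ((Real.exp (-(n * u)) : ℝ) : ℂ))
      (Ioi 0) := by
    refine Integrable.mono' (integrableOn_rpow_mul_exp_neg_mul (s := -(1 / 2)) (by norm_num) hn0)
      ?_ ((ae_restrict_iff' measurableSet_Ioi).2 (Filter.Eventually.of_forall fun u hu => ?_))
    · exact (by fun_prop : Measurable fun u : ℝ =>
        (u : ℂ) ^ (b - 1) * ((Real.exp (-(n * u)) : ℝ) : ℂ)).aestronglyMeasurable
    · rw [norm_mul, norm_cpow_eq_rpow_re_of_pos hu, norm_real, Real.norm_eq_abs, Real.abs_exp]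
      refine le_of_eq ?_
      congr 2
      simp [hb]
      norm_num
  rw [hB, hG, ← integral_sub hBi hGi]
  have hpt : ∀ u ∈ Ioi (0 : ℝ), ‖(u : ℂ) ^ (b - 1) *
        (((Iio (1 : ℝ)).indicator (fun u => (1 - u) ^ n) u : ℝ) : ℂ) -
        (u : ℂ) ^ (b - 1) * ((Real.exp (-(n * u)) : ℝ) : ℂ)‖ ≤
      n * (u ^ ((5 / 2 : ℝ) - 1) * Real.exp (-(n * u))) := by
    intro u hu
    rw [← mul_sub, norm_mul, ← ofReal_sub, norm_real, Real.norm_eq_abs,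
      norm_cpow_eq_rpow_re_of_pos hu]
    refine (mul_le_mul_of_nonneg_left (abs_indicator_one_sub_pow_sub_exp_le hn hu)
      (Real.rpow_nonneg (le_of_lt hu) _)).trans (le_of_eq ?_)
    have : u ^ ((5 / 2 : ℝ) - 1) = u ^ (b - 1).re * u ^ 2 := by
      rw [← Real.rpow_natCast u 2, ← Real.rpow_add hu]
      congr 1
      simp [hb]
      norm_num
    rw [this]
    ring
  have hi : IntegrableOn (fun u : ℝ => u ^ ((5 / 2 : ℝ) - 1) * Real.exp (-(n * u))) (Ioi 0) :=
    integrableOn_rpow_mul_exp_neg_mul (by norm_num) hn0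
  refine (norm_integral_le_of_norm_le (hi.const_mul _)
    ((ae_restrict_iff' measurableSet_Ioi).2 (Filter.Eventually.of_forall hpt))).trans ?_
  rw [integral_const_mul, Real.integral_rpow_mul_exp_neg_mul_Ioi (by norm_num) hn0]
  have hp : (1 / (n : ℝ)) ^ (5 / 2 : ℝ) ≤ (1 / (n : ℝ)) ^ (2 : ℝ) :=
    Real.rpow_le_rpow_of_exponent_ge (by positivity) (by rw [div_le_one hn0]; exact hn1)
      (by norm_num)
  have hΓ : 0 < Real.Gamma (5 / 2) := Real.Gamma_pos_of_pos (by norm_num)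
  calc (n : ℝ) * ((1 / n) ^ (5 / 2 : ℝ) * Real.Gamma (5 / 2))
      ≤ n * ((1 / n) ^ (2 : ℝ) * Real.Gamma (5 / 2)) := by gcongr
    _ = Real.Gamma (5 / 2) / n := by
      rw [Real.rpow_two]
      field_simp

/-! ### Integration against `(1 - e^{-x})^n` and the pointwise estimate -/

theorem expBeta_natCast_add_one (u : ℂ) (n : ℕ) (t : ℝ) :
    expBeta u (n + 1) t = cexp (-u * t) * ((1 - Real.exp (-t) : ℝ) : ℂ) ^ n := by
  rw [expBeta, add_sub_cancel_right, cpow_natCast]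

theorem integral_exp_neg_mul_one_sub_pow (m : ℕ) :
    IntegrableOn (fun t : ℝ => Real.exp (-t) * (1 - Real.exp (-t)) ^ m) (Ioi 0) ∧
      ∫ t in Ioi (0 : ℝ), Real.exp (-t) * (1 - Real.exp (-t)) ^ m = 1 / (m + 1) := by
  have e : ∀ t : ℝ, expBeta 1 (m + 1) t =
      ((Real.exp (-t) * (1 - Real.exp (-t)) ^ m : ℝ) : ℂ) := by
    intro t
    rw [expBeta_natCast_add_one]
    push_cast
    ring_nf
  have hm : 0 < ((m : ℂ) + 1).re := by simp; positivity
  have hi := integrableOn_expBeta (u := 1) (by simp) hm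
  have hv := integral_expBeta 1 (m + 1)
  simp only [funext e] at hi
  simp only [e, integral_complex_ofReal] at hv
  rw [betaIntegral_symm, betaIntegral_eval_one_right hm] at hv
  refine ⟨hi.re, ofReal_injective ?_⟩
  rw [hv]
  push_cast
  rfl

theorem abs_mul_qPoly_sub_im_le {ξ : ℝ} {b : ℂ} (hb : b = 1 / 2 - I * ξ) {n : ℕ}
    (hn : 1 ≤ n) :
    |ξ * (normSq (Gamma b) ^ 2 * qPoly n ξ) -
        ((1 - b) * betaIntegral (2 - 2 * b) b * betaIntegral b (n + 1)).im| ≤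
      2 * (2 * ‖1 - 2 * b‖ * ‖b‖ + ‖1 - b‖ + ‖b‖) / n := by
  -- One factor `1 - exp (-x)` is reserved to cancel the singularity of the error bound at `x = 0`;
  -- the other `m` factors leave `B(1, m + 1) = 1 / n`.
  obtain ⟨m, rfl⟩ : ∃ m, n = m + 1 := ⟨n - 1, by omega⟩
  have hbre : b.re = 1 / 2 := by simp [hb]
  have hb0 : 0 < b.re := by rw [hbre]; norm_num
  have hconj : (starRingEnd ℂ) b = 1 - b := by
    rw [hb, map_sub, map_mul, conj_I, conj_ofReal, map_div₀, map_one, map_ofNat]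
    ring
  have hconj' : (starRingEnd ℂ) (1 - b) = b := by rw [← hconj, conj_conj]
  have hare : 0 < (1 - b).re := by rw [← hconj]; simpa using hb0
  have hu : 1 - 2 * b = 2 * ξ * I := by rw [hb]; ring
  set G := (1 - b) * betaIntegral (2 - 2 * b) b
  set C := 2 * ‖1 - 2 * b‖ * ‖b‖ + ‖1 - b‖ + ‖b‖
  have hC : 0 ≤ C := by positivity
  set Ψ := expBetaConv (1 - b) b b (1 - b) with hΨ
  have hΨi : IntegrableOn Ψ (Ioi 0) := integrableOn_expBetaConv hare hb0 hb0 hare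
  have hpoint : ∀ x ∈ Ioi (0 : ℝ), |ξ * (Ψ x).re - (G * cexp (-b * x)).im| ≤
      2 * C * (Real.exp (-x) * (1 - Real.exp (-x))⁻¹) := by
    intro x hx
    have h1 := norm_half_conv_sub_main_le hbre hx
    have h2 := expBetaConv_conj_re (1 - b) hb0 hx
    rw [hconj, hconj', ← hΨ] at h2
    rw [h2]
    set Ψ₁ := ∫ t in (0 : ℝ)..x / 2, expBeta (1 - b) b t * expBeta b (1 - b) (x - t)
    have h3 := (abs_im_le_norm _).trans h1
    -- The real boundary term disappears here, and `1 - 2b = 2iξ` turns the imaginary part of the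
    -- half integral into `ξ` times the full `Ψ`.
    rw [sub_im, sub_im, ofReal_im, sub_zero, hu] at h3
    have h4 : (2 * ξ * I * Ψ₁).im = ξ * (2 * Ψ₁.re) := by simp; ring
    rw [h4] at h3
    refine h3.trans ?_
    rw [← hu]
    change C * _ ≤ _
    have hw := one_sub_exp_neg_pos (half_pos hx)
    have hX := one_sub_exp_neg_pos hx
    have hsq : Real.exp (-x) = Real.exp (-(x / 2)) * Real.exp (-(x / 2)) := by
      rw [← Real.exp_add]; congr 1; ring
    -- With `w = exp (-(x / 2))`, `1 - w² = (1 - w)(1 + w) ≤ 2(1 - w)`.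
    have h5 : (1 - Real.exp (-(x / 2)))⁻¹ ≤ 2 * (1 - Real.exp (-x))⁻¹ := by
      rw [← div_eq_mul_inv, inv_eq_one_div, div_le_div_iff₀ hw hX, hsq]
      nlinarith
    rw [div_eq_mul_inv]
    calc C * (Real.exp (-x) * (1 - Real.exp (-(x / 2)))⁻¹)
        ≤ C * (Real.exp (-x) * (2 * (1 - Real.exp (-x))⁻¹)) := by gcongr
      _ = _ := by ring
  have hrep := qPoly_mul_eq_integral ξ (a := 1 - b) (by rw [hb]; ring) hb (m + 1)
  have hΨn : IntegrableOn (fun x : ℝ => ((1 - Real.exp (-x) : ℝ) : ℂ) ^ (m + 1) * Ψ x) (Ioi 0) := by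
    refine hΨi.bdd_mul (c := 1) (Continuous.aestronglyMeasurable (by fun_prop)) ?_
    refine (ae_restrict_iff' measurableSet_Ioi).2 (Filter.Eventually.of_forall fun x hx => ?_)
    have hX := one_sub_exp_neg_pos hx
    rw [norm_pow, norm_real, Real.norm_eq_abs, abs_of_pos hX]
    exact pow_le_one₀ hX.le (by linarith [Real.exp_pos (-x)])
  have hGn : IntegrableOn (fun x => G * expBeta b ((m + 1 : ℕ) + 1) x) (Ioi 0) :=
    (integrableOn_expBeta hb0 (by simp; positivity)).const_mul _
  have hN : (Gamma (1 - b) * Gamma b) ^ 2 = ((normSq (Gamma b) ^ 2 : ℝ) : ℂ) := by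
    rw [← hconj, Gamma_conj, ← normSq_eq_conj_mul_self, ofReal_pow]
  rw [hN] at hrep
  have e1 : ξ * (normSq (Gamma b) ^ 2 * qPoly (m + 1) ξ) =
      ∫ x in Ioi (0 : ℝ), ξ * ((1 - Real.exp (-x)) ^ (m + 1) * (Ψ x).re) := by
    have h := congrArg re hrep
    have h' := reCLM.integral_comp_comm hΨn
    simp only [reCLM_apply] at h'
    rw [← h', ← ofReal_mul, ofReal_re] at h
    rw [integral_const_mul, h]
    congr 1
    refine integral_congr_ae (Filter.Eventually.of_forall fun x => ?_)
    simp only [← ofReal_pow, re_ofReal_mul]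
  have e2 : (G * betaIntegral b ((m + 1 : ℕ) + 1)).im =
      ∫ x in Ioi (0 : ℝ), (1 - Real.exp (-x)) ^ (m + 1) * (G * cexp (-b * x)).im := by
    have h' := imCLM.integral_comp_comm hGn
    simp only [imCLM_apply] at h'
    rw [← integral_expBeta, ← integral_const_mul, ← h']
    refine integral_congr_ae (Filter.Eventually.of_forall fun x => ?_)
    simp only [expBeta_natCast_add_one]
    rw [← mul_assoc, mul_comm, ← ofReal_pow, im_ofReal_mul]
  have i1 : IntegrableOn (fun x => ξ * ((1 - Real.exp (-x)) ^ (m + 1) * (Ψ x).re)) (Ioi 0) := by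
    have h := (reCLM.integrable_comp hΨn).const_mul ξ
    refine h.congr (Filter.Eventually.of_forall fun x => ?_)
    simp only [reCLM_apply, ← ofReal_pow, re_ofReal_mul]
  have i2 : IntegrableOn (fun x : ℝ => (1 - Real.exp (-x)) ^ (m + 1) * (G * cexp (-b * x)).im)
      (Ioi 0) := by
    have h := imCLM.integrable_comp hGn
    refine h.congr (Filter.Eventually.of_forall fun x => ?_)
    simp only [imCLM_apply, expBeta_natCast_add_one]
    rw [← mul_assoc, mul_comm, ← ofReal_pow, im_ofReal_mul]
  rw [e1, e2, ← integral_sub i1 i2, ← Real.norm_eq_abs]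
  obtain ⟨hmi, hmv⟩ := integral_exp_neg_mul_one_sub_pow m
  refine (norm_integral_le_of_norm_le (hmi.const_mul (2 * C))
    ((ae_restrict_iff' measurableSet_Ioi).2 (Filter.Eventually.of_forall fun x hx => ?_))).trans ?_
  · have hX := one_sub_exp_neg_pos hx
    rw [show ξ * ((1 - Real.exp (-x)) ^ (m + 1) * (Ψ x).re) -
        (1 - Real.exp (-x)) ^ (m + 1) * (G * cexp (-b * x)).im =
        (1 - Real.exp (-x)) ^ (m + 1) * (ξ * (Ψ x).re - (G * cexp (-b * x)).im) by ring,
      norm_mul, Real.norm_eq_abs, Real.norm_eq_abs, abs_of_pos (pow_pos hX _)]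
    refine (mul_le_mul_of_nonneg_left (hpoint x hx) (pow_pos hX _).le).trans (le_of_eq ?_)
    rw [pow_succ]
    field_simp
  · rw [integral_const_mul, hmv]
    push_cast
    rw [mul_one_div]

/-- Conjugation sends `b` to `1 - b`, so `|Γ(b)|² = Γ(b) Γ(1 - b)`; the factor `1 - b` cancels
against `Γ(2 - b) = (1 - b) Γ(1 - b)`. -/
theorem gammaQuotient_eq (ξ : ℝ) {b : ℂ} (hb : b = 1 / 2 - I * ξ) :
    (1 - b) * betaIntegral (2 - 2 * b) b * Gamma b =
      ((normSq (Gamma b) ^ 2 : ℝ) : ℂ) * gammaQuotient ξ := by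
  have hbre : b.re = 1 / 2 := by simp [hb]
  have hb0 : 0 < b.re := by rw [hbre]; norm_num
  have hconj : (starRingEnd ℂ) b = 1 - b := by
    rw [hb, map_sub, map_mul, conj_I, conj_ofReal, map_div₀, map_one, map_ofNat]
    ring
  have ha0 : 0 < (1 - b).re := by rw [← hconj]; simpa using hb0
  have hne : (1 - b) ≠ 0 := fun h => by rw [h] at ha0; simp at ha0
  have hΓa := Gamma_ne_zero_of_re_pos ha0
  have e1 : 1 + 2 * I * (ξ : ℂ) = 2 - 2 * b := by rw [hb]; ring
  have e2 : 1 / 2 + I * (ξ : ℂ) = 1 - b := by rw [hb]; ring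
  have e3 : Gamma (2 - 2 * b + b) = (1 - b) * Gamma (1 - b) := by
    rw [← Gamma_add_one _ hne]; congr 1; ring
  rw [gammaQuotient, e1, e2, betaIntegral_eq_Gamma_mul_div _ _ (by simp [hbre]) hb0, e3,
    ofReal_pow, normSq_eq_conj_mul_self, ← Gamma_conj, hconj]
  field_simp

theorem natCast_cpow_neg_eq (ξ : ℝ) {b : ℂ} (hb : b = 1 / 2 - I * ξ) {n : ℕ} (hn : 1 ≤ n) :
    (n : ℂ) ^ (-b) = ((1 / Real.sqrt n : ℝ) : ℂ) *
      ((Real.cos (ξ * Real.log n) : ℝ) + (Real.sin (ξ * Real.log n) : ℝ) * I) := by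
  have hn0 : (0 : ℝ) < n := by exact_mod_cast hn
  have hne : (n : ℂ) ≠ 0 := by exact_mod_cast hn0.ne'
  have e : -b = ((-(1 / 2) : ℝ) : ℂ) + ξ * I := by rw [hb]; push_cast; ring
  rw [e, cpow_add _ _ hne, ← ofReal_natCast n, ← ofReal_cpow hn0.le, Real.rpow_neg hn0.le,
    ← Real.sqrt_eq_rpow, one_div]
  congr 1
  rw [cpow_def_of_ne_zero (by exact_mod_cast hne), ← ofReal_log hn0.le,
    show (Real.log n : ℂ) * (ξ * I) = ((ξ * Real.log n : ℝ) : ℂ) * I by push_cast; ring,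
    exp_mul_I, ofReal_cos, ofReal_sin]

/-! ### Error constant and uniformity in `ξ` -/

/-- The constant of the error term at the single point `ξ`, where `b = 1 / 2 - iξ`. -/
noncomputable def errorConst (b : ℂ) : ℝ :=
  (2 * (2 * ‖1 - 2 * b‖ * ‖b‖ + ‖1 - b‖ + ‖b‖) +
    ‖(1 - b) * (Gamma (2 - 2 * b) * Gamma b / Gamma (2 - b))‖ * Real.Gamma (5 / 2)) /
      normSq (Gamma b) ^ 2

theorem abs_qPoly_sub_main_le {ξ : ℝ} (hξ : 0 < ξ) {n : ℕ} (hn : 1 ≤ n) :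
    |qPoly n ξ - 1 / (ξ * Real.sqrt (n : ℝ)) *
        ((gammaQuotient ξ).im * Real.cos (ξ * Real.log (n : ℝ)) +
          (gammaQuotient ξ).re * Real.sin (ξ * Real.log (n : ℝ)))| ≤
      errorConst (1 / 2 - I * ξ) / (n * ξ) := by
  obtain ⟨b, hb⟩ : ∃ b : ℂ, b = 1 / 2 - I * ξ := ⟨_, rfl⟩
  rw [← hb]
  have hn0 : (0 : ℝ) < n := by exact_mod_cast hn
  have hbre : b.re = 1 / 2 := by simp [hb]
  have hb0 : 0 < b.re := by rw [hbre]; norm_num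
  have hN : 0 < normSq (Gamma b) ^ 2 :=
    pow_pos (normSq_pos.2 (Gamma_ne_zero_of_re_pos hb0)) 2
  have h1 := abs_mul_qPoly_sub_im_le hb hn
  have h2 := norm_betaIntegral_sub_Gamma_le hbre hn
  have h3 := gammaQuotient_eq ξ hb
  have h4 := natCast_cpow_neg_eq ξ hb hn
  have hG : (1 - b) * betaIntegral (2 - 2 * b) b =
      (1 - b) * (Gamma (2 - 2 * b) * Gamma b / Gamma (2 - b)) := by
    rw [betaIntegral_eq_Gamma_mul_div _ _ (by simp [hbre]) hb0]
    congr 4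
    ring
  unfold errorConst
  rw [← hG]
  set G := (1 - b) * betaIntegral (2 - 2 * b) b
  set N := normSq (Gamma b) ^ 2
  set M := 1 / Real.sqrt (n : ℝ) * ((gammaQuotient ξ).im * Real.cos (ξ * Real.log (n : ℝ)) +
          (gammaQuotient ξ).re * Real.sin (ξ * Real.log (n : ℝ))) with hM
  -- The oscillating main term is `Im (F(ξ) e^{iξ log n})` divided by `√n`.
  have h5 : (G * ((n : ℂ) ^ (-b) * Gamma b)).im = N * M := by
    have : G * ((n : ℂ) ^ (-b) * Gamma b) = ((N * (1 / Real.sqrt n) : ℝ) : ℂ) *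
        (gammaQuotient ξ *
          ((Real.cos (ξ * Real.log n) : ℝ) + (Real.sin (ξ * Real.log n) : ℝ) * I)) := by
      rw [h4]
      rw [ofReal_mul]
      linear_combination (((1 / Real.sqrt n : ℝ) : ℂ) *
        ((Real.cos (ξ * Real.log n) : ℝ) + (Real.sin (ξ * Real.log n) : ℝ) * I)) * h3
    rw [this, im_ofReal_mul, hM, mul_im, add_re, add_im, mul_I_re, mul_I_im, ofReal_re, ofReal_im,
      ofReal_re, ofReal_im]
    ring
  have h6 : |(G * betaIntegral b (n + 1)).im - N * M| ≤ ‖G‖ * (Real.Gamma (5 / 2) / n) := by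
    rw [← h5, ← sub_im, ← mul_sub]
    refine (abs_im_le_norm _).trans ?_
    rw [norm_mul]
    gcongr
  have h7 : |ξ * N * (qPoly n ξ - M / ξ)| ≤
      (2 * (2 * ‖1 - 2 * b‖ * ‖b‖ + ‖1 - b‖ + ‖b‖) + ‖G‖ * Real.Gamma (5 / 2)) / n := by
    have e : ξ * N * (qPoly n ξ - M / ξ) = (ξ * (N * qPoly n ξ) - (G * betaIntegral b (n + 1)).im) +
        ((G * betaIntegral b (n + 1)).im - N * M) := by
      field_simp
      ring
    rw [e, add_div, mul_div_assoc ‖G‖]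
    exact (abs_add_le _ _).trans (add_le_add h1 h6)
  have e : 1 / (ξ * Real.sqrt (n : ℝ)) * ((gammaQuotient ξ).im * Real.cos (ξ * Real.log (n : ℝ)) +
      (gammaQuotient ξ).re * Real.sin (ξ * Real.log (n : ℝ))) = M / ξ := by
    rw [hM]
    field_simp
  rw [e]
  rw [abs_mul, abs_of_pos (mul_pos hξ hN)] at h7
  rw [div_div, le_div_iff₀ (by positivity)]
  rw [le_div_iff₀ hn0] at h7
  linarith

/-- The factor `1/ξ` has been split off, so nothing degenerates at `ξ = 0`: all Gamma arguments stay
in the right half-plane. This allows compactness of the closed interval `[0, K]`. -/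
theorem continuous_errorConst_line : Continuous fun ξ : ℝ => errorConst (1 / 2 - I * ξ) := by
  have hΓ : ∀ f : ℝ → ℂ, Continuous f → (∀ ξ, 0 < (f ξ).re) → Continuous fun ξ => Gamma (f ξ) := by
    intro f hf hpos
    refine continuous_iff_continuousAt.2 fun ξ => ?_
    refine ContinuousAt.comp (g := Gamma) (DifferentiableAt.continuousAt
      (differentiableAt_Gamma _ fun m h => ?_)) hf.continuousAt
    have := hpos ξ
    rw [h] at this
    simp at this
    linarith [(Nat.cast_nonneg m : (0 : ℝ) ≤ m)]
  have p1 : ∀ ξ : ℝ, 0 < (1 / 2 - I * ξ : ℂ).re := fun ξ => by simp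
  have p2 : ∀ ξ : ℝ, 0 < (2 - 2 * (1 / 2 - I * ξ) : ℂ).re := fun ξ => by simp
  have p3 : ∀ ξ : ℝ, 0 < (2 - (1 / 2 - I * ξ) : ℂ).re := fun ξ => by simp; norm_num
  have g1 := hΓ _ (by fun_prop) p1
  have g2 := hΓ _ (by fun_prop) p2
  have g3 := hΓ _ (by fun_prop) p3
  unfold errorConst
  refine Continuous.div (Continuous.add (by fun_prop) (Continuous.mul (Continuous.norm
    (Continuous.mul (by fun_prop) ((g2.mul g1).div g3 fun ξ => Gamma_ne_zero_of_re_pos (p3 ξ))))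
    continuous_const)) ((continuous_normSq.comp g1).pow 2) fun ξ => ?_
  exact pow_ne_zero 2 (normSq_pos.2 (Gamma_ne_zero_of_re_pos (p1 ξ))).ne'

theorem mainTheorem5 (K : ℝ) (hK : 0 < K) :
    ∃ C : ℝ, 0 < C ∧ ∃ R : ℕ → ℝ → ℝ,
      ∀ ξ : ℝ, 0 < ξ → ξ ≤ K → ∀ n : ℕ, 1 ≤ n →
        qPoly n ξ =
            1 / (ξ * Real.sqrt (n : ℝ)) *
              ((gammaQuotient ξ).im * Real.cos (ξ * Real.log (n : ℝ)) +
                (gammaQuotient ξ).re * Real.sin (ξ * Real.log (n : ℝ))) +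
              R n ξ ∧
          |R n ξ| ≤ C / ((n : ℝ) * ξ) := by
  obtain ⟨C, hC⟩ := (isCompact_Icc (a := (0 : ℝ)) (b := K)).exists_bound_of_continuousOn
    continuous_errorConst_line.continuousOn
  -- The maximum with `1` only serves to make the constant positive.
  refine ⟨max C 1, lt_max_of_lt_right one_pos, fun n ξ => qPoly n ξ - 1 / (ξ * Real.sqrt (n : ℝ)) *
    ((gammaQuotient ξ).im * Real.cos (ξ * Real.log (n : ℝ)) +
      (gammaQuotient ξ).re * Real.sin (ξ * Real.log (n : ℝ))), ?_⟩
  intro ξ hξ hξK n hn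
  refine ⟨by ring, (abs_qPoly_sub_main_le hξ hn).trans ?_⟩
  have h := (Real.le_norm_self _).trans (hC ξ ⟨hξ.le, hξK⟩)
  gcongr
  exact h.trans (le_max_left _ _)
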